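/- Consider the synchronous dispersion process on the two-way infinite path, the graph with vertex set $\mathbb{Z}$ and edges $\{i,i+1\}$ for $i\in\mathbb{Z}$. At time $0$ there are $n$ particles, all at the origin. At each time step, every particle located at a vertex that holds at least two particles moves to one of the two neighbouring vertices, chosen uniformly at random, independently of the other particles and of the past; these moves are simultaneous, and all other particles stay where they are. The process stops at the first time $T_n$ at which every vertex holds at most one particle ($T_n=\infty$ if there is no such time). Let $D_n$ be the largest distance of a particle from the origin at time $T_n$. Then there is an absolute constant $C>0$ such that $$\lim_{n\to\infty}\Pr\left(T_n<\infty\ \text{and}\ D_n\le C\,n\right)=1 .$$ -/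

import Mathlib

open MeasureTheory Filter Topology

namespace Dispersion

/-- The number of particles located at the site `v` in the configuration `x`,
where `x i` is the position of the particle `i`. -/
def stackSize {n : ℕ} (x : Fin n → ℤ) (v : ℤ) : ℕ :=
  (Finset.univ.filter fun j => x j = v).card

/-- One synchronous step on the two-way infinite path, where the neighbours of `v` are `v - 1` and
`v + 1`: every particle in a stack of size at least two moves to the neighbour selected by its own
coin (right for `true`, left for `false`); all other particles stay (their coins are not used). -/
def step {n : ℕ} (x : Fin n → ℤ) (c : Fin n → Bool) : Fin n → ℤ := fun i =>
  if 2 ≤ stackSize x (x i) then (if c i then x i + 1 else x i - 1) else x i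

/-- The configuration at time `t`, started from `n` particles at the origin; `ω t i` is the coin
of the particle `i` for the step from time `t` to time `t + 1`. -/
def position {n : ℕ} (ω : ℕ → Fin n → Bool) : ℕ → Fin n → ℤ
  | 0 => fun _ => 0
  | t + 1 => step (position ω t) (ω t)

/-- Every site holds at most one particle. -/
def IsDispersed {n : ℕ} (x : Fin n → ℤ) : Prop := ∀ v : ℤ, stackSize x v ≤ 1

/-- The process stops at time `T`: this is the first time at which every site holds at most one
particle. -/
def StopsAt {n : ℕ} (ω : ℕ → Fin n → Bool) (T : ℕ) : Prop :=
  IsDispersed (position ω T) ∧ ∀ t < T, ¬ IsDispersed (position ω t)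

/-- The law of independent fair coins, one for each time and each of the `n` particles. -/
noncomputable def coinLaw (n : ℕ) : Measure (ℕ → Fin n → Bool) :=
  Measure.infinitePi fun _ : ℕ => Measure.pi fun _ : Fin n =>
    (PMF.uniformOfFintype Bool).toMeasure

end Dispersion

/-!
For every fixed time `t`, record at each site `v` the word of all coins used there before time `t`.
The words determine the trajectory up to time `t` (`coin_eq_of_word_eq`), so a given family of words
has probability at most `2 ^ (-m)`, where `m` is its total length. It remains to sum this weight
over all families of words that are compatible with a long interval of visited sites.

The first constraint is the conservation of particles (`stackSize_position_add`): reading the sites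
from left to right, the numbers of particles and the words of the sites up to `v` prescribe the
number of letters `false` (moves to the left) in the word of `v + 1`. The words with a prescribed
number of letters `false` have total weight at most `2`, however long they are (`tsum_word_le`).

The second constraint concerns the visited sites that are empty at time `t`. If `v` and `v + 1` are
both empty, it is impossible that the last group that left `v` sent a particle to the right and the
last group that left `v + 1` sent one to the left (`not_true_mem_and_false_mem`). As a group has at
least two members, the two newest letters of every word belong to the last group; hence along a gap
the two newest letters are first both moves to the left, then at most one word is different, and in
all further words they are both moves to the right. With two letters prescribed, the total weight
of the words drops from `2` to `1 / 2`. A gap of length `g` thus has weight of order `g * 2 ^ (-g)`, and since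
there are at most `n` occupied sites, an interval of `L` visited sites has probability at most
`8 * 65 ^ n * (3 / 4) ^ L` for each position relative to the origin (`tsum_list_le`). This beats
`65 ^ n` for `L ≥ 64 * n`. The bound is uniform in `t` and the set of visited sites increases with
`t`, so it holds for all times together (`coinLaw_exists_visited_le`).

The sum of the weights of all admissible families is finite, and a process that has not stopped by
time `t` has words of total length at least `t`; therefore it stops almost surely
(`coinLaw_forall_not_isDispersed`).
-/

namespace Dispersion

open scoped ENNReal

variable {n : ℕ}

/-! ### The words of coins used at the sites -/

/-- The particles that leave the site `v` in one step, in increasing order of their labels. -/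
def movers {n : ℕ} (x : Fin n → ℤ) (v : ℤ) : List (Fin n) :=
  if 2 ≤ stackSize x v then (List.finRange n).filter fun i => x i = v else []

/-- The coins used by the particles that leave `v` before time `t`, the newest first. Coins used
in the same step are listed in increasing order of the labels of the particles. -/
def word {n : ℕ} (ω : ℕ → Fin n → Bool) : ℕ → ℤ → List Bool
  | 0, _ => []
  | t + 1, v => (movers (position ω t) v).map (ω t) ++ word ω t v

lemma mem_movers {x : Fin n → ℤ} {v : ℤ} {i : Fin n} :
    i ∈ movers x v ↔ 2 ≤ stackSize x v ∧ x i = v := by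
  unfold movers
  split_ifs with h <;> simp [h]

lemma countP_movers (x : Fin n → ℤ) (v : ℤ) (q : Fin n → Bool) :
    (movers x v).countP q =
      (Finset.univ.filter fun i => (2 ≤ stackSize x (x i) ∧ x i = v) ∧ q i = true).card := by
  have h : (Finset.univ.filter fun i => (2 ≤ stackSize x (x i) ∧ x i = v) ∧ q i = true) =
      ((movers x v).filter q).toFinset := by
    ext i
    simp only [Finset.mem_filter, Finset.mem_univ, true_and, List.mem_toFinset, List.mem_filter,
      mem_movers]
    constructor
    · rintro ⟨⟨h, rfl⟩, hq⟩
      exact ⟨⟨h, rfl⟩, hq⟩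
    · rintro ⟨⟨h, rfl⟩, hq⟩
      exact ⟨⟨h, rfl⟩, hq⟩
  have hd : ((movers x v).filter q).Nodup := by
    apply List.Nodup.filter
    unfold movers
    split_ifs
    · exact (List.nodup_finRange n).filter _
    · exact List.nodup_nil
  rw [h, List.toFinset_card_of_nodup hd, List.countP_eq_length_filter]

lemma length_movers (x : Fin n → ℤ) (v : ℤ) :
    (movers x v).length =
      (Finset.univ.filter fun i => 2 ≤ stackSize x (x i) ∧ x i = v).card := by
  have h := countP_movers x v fun _ => true
  simpa using h

lemma length_movers_of_two_le {x : Fin n → ℤ} {v : ℤ} (h : 2 ≤ stackSize x v) :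
    (movers x v).length = stackSize x v := by
  rw [length_movers, stackSize]
  congr 1
  ext i
  simp only [Finset.mem_filter, Finset.mem_univ, true_and, and_iff_right_iff_imp]
  rintro rfl
  exact h

lemma movers_of_not_two_le {x : Fin n → ℤ} {v : ℤ} (h : ¬ 2 ≤ stackSize x v) :
    movers x v = [] := by
  simp [movers, h]

lemma count_map_movers (x : Fin n → ℤ) (c : Fin n → Bool) (v : ℤ) (b : Bool) :
    ((movers x v).map c).count b =
      (Finset.univ.filter fun i => (2 ≤ stackSize x (x i) ∧ x i = v) ∧ c i = b).card := by
  rw [List.count, List.countP_map, countP_movers]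
  simp

lemma stackSize_eq_sum (x : Fin n → ℤ) (v : ℤ) :
    stackSize x v = ∑ i, if x i = v then 1 else 0 :=
  Finset.card_filter _ _

/-- Conservation of particles in one step. -/
lemma stackSize_step_add (x : Fin n → ℤ) (c : Fin n → Bool) (v : ℤ) :
    stackSize (step x c) v + (movers x v).length =
      stackSize x v + ((movers x (v - 1)).map c).count true +
        ((movers x (v + 1)).map c).count false := by
  rw [length_movers, count_map_movers, count_map_movers, stackSize_eq_sum _ v,
    stackSize_eq_sum x v]
  simp only [Finset.card_filter]
  rw [← Finset.sum_add_distrib, ← Finset.sum_add_distrib, ← Finset.sum_add_distrib]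
  refine Finset.sum_congr rfl fun i _ => ?_
  unfold step
  by_cases hm : 2 ≤ stackSize x (x i)
  · cases c i
    · have h : x i - 1 = v ↔ x i = v + 1 := by omega
      simp [hm, h, add_comm]
    · have h : x i + 1 = v ↔ x i = v - 1 := by omega
      simp [hm, h, add_comm]
  · simp [hm]

lemma stackSize_zero_position (ω : ℕ → Fin n → Bool) (v : ℤ) :
    stackSize (position ω 0) v = if v = 0 then n else 0 := by
  unfold stackSize position
  by_cases h : v = 0
  · simp [h]
  · simp [h, Ne.symm h]

/-- Conservation of particles up to time `t`. -/
lemma stackSize_position_add (ω : ℕ → Fin n → Bool) (t : ℕ) (v : ℤ) :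
    stackSize (position ω t) v + (word ω t v).length =
      (if v = 0 then n else 0) + (word ω t (v - 1)).count true +
        (word ω t (v + 1)).count false := by
  induction t with
  | zero => simp [word, stackSize_zero_position]
  | succ t ih =>
    have h := stackSize_step_add (position ω t) (ω t) v
    simp only [word, position, List.length_append, List.length_map, List.count_append]
    omega

/-- The words used up to time `t` determine the configurations up to time `t`, and all the coins
that were used. -/
lemma coin_eq_of_word_eq {ω ω' : ℕ → Fin n → Bool} {t : ℕ}
    (h : ∀ v, word ω t v = word ω' t v) :
    ∀ s < t, ∀ i, 2 ≤ stackSize (position ω' s) (position ω' s i) → ω s i = ω' s i := by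
  have suffix : ∀ (η : ℕ → Fin n → Bool) (v : ℤ) {s u : ℕ}, s ≤ u →
      word η s v <:+ word η u v := by
    intro η v s u hsu
    induction u, hsu using Nat.le_induction with
    | base => exact List.suffix_refl _
    | succ u _ ih => exact ih.trans (List.suffix_append _ _)
  have key : ∀ s ≤ t, position ω s = position ω' s ∧ ∀ v, word ω s v = word ω' s v := by
    intro s
    induction s with
    | zero => intro _; exact ⟨rfl, fun v => rfl⟩
    | succ s ih =>
      intro hs
      obtain ⟨hp, hw⟩ := ih (by omega)
      -- both words at time `s + 1` are suffixes of the same length of the common final word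
      have hw' : ∀ v, word ω (s + 1) v = word ω' (s + 1) v := by
        intro v
        have h1 := suffix ω v hs
        have h2 := suffix ω' v hs
        rw [h v] at h1
        have hl : (word ω (s + 1) v).length = (word ω' (s + 1) v).length := by
          simp [word, hp, hw]
        exact (List.suffix_of_suffix_length_le h1 h2 hl.le).eq_of_length hl
      refine ⟨?_, hw'⟩
      ext i
      simp only [position, step, hp]
      split_ifs with h2 h3 h4 h4 <;> try rfl
      all_goals
        exfalso
        have h5 := hw' (position ω' s i)
        simp only [word, hp, hw, List.append_cancel_right_eq] at h5
        have := List.map_inj_left.1 h5 i (mem_movers.2 ⟨h2, rfl⟩)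
        simp_all
  intro s hs i hi
  obtain ⟨hp, hw⟩ := key s hs.le
  have h5 := (key (s + 1) hs).2 (position ω' s i)
  simp only [word, hp, hw, List.append_cancel_right_eq] at h5
  exact List.map_inj_left.1 h5 i (mem_movers.2 ⟨hi, rfl⟩)

/-! ### Empty sites -/

lemma stackSize_le_step_of_not_two_le {x : Fin n → ℤ} {v : ℤ} (c : Fin n → Bool)
    (h : ¬ 2 ≤ stackSize x v) : stackSize x v ≤ stackSize (step x c) v := by
  have := stackSize_step_add x c v
  simp only [movers_of_not_two_le h, List.length_nil] at this
  omega

lemma two_le_length_word {ω : ℕ → Fin n → Bool} {t : ℕ} {v : ℤ} (h : word ω t v ≠ []) :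
    2 ≤ (word ω t v).length := by
  induction t with
  | zero => exact absurd rfl h
  | succ t ih =>
    by_cases h2 : 2 ≤ stackSize (position ω t) v
    · simp only [word, List.length_append, List.length_map, length_movers_of_two_le h2]
      omega
    · simp only [word, movers_of_not_two_le h2, List.map_nil, List.nil_append] at h ⊢
      exact ih h

/-- If `v` and `v + 1` are both empty, it cannot be that the last group that left `v` sent a
particle to the right while the last group that left `v + 1` sent one to the left: the later of
the two would have filled a site that is not left afterwards. The first two letters of a word
always belong to the last group. -/
lemma not_true_mem_and_false_mem {ω : ℕ → Fin n → Bool} {t : ℕ} {v : ℤ}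
    (h0 : stackSize (position ω t) v = 0) (h1 : stackSize (position ω t) (v + 1) = 0) :
    ¬ (true ∈ (word ω t v).take 2 ∧ false ∈ (word ω t (v + 1)).take 2) := by
  induction t with
  | zero => simp [word]
  | succ t ih =>
    rintro ⟨ht, hf⟩
    have e0 := stackSize_step_add (position ω t) (ω t) v
    have e1 := stackSize_step_add (position ω t) (ω t) (v + 1)
    simp only [position] at h0 h1
    rw [add_sub_cancel_right] at e1
    have m0 : 2 ≤ stackSize (position ω t) v → False := by
      intro h
      have hl := length_movers_of_two_le h
      have htk : true ∈ (movers (position ω t) v).map (ω t) := by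
        rw [word, List.take_append_of_le_length (by simp [hl, h])] at ht
        exact List.mem_of_mem_take ht
      have := List.count_pos_iff.2 htk
      by_cases h' : 2 ≤ stackSize (position ω t) (v + 1)
      · have := length_movers_of_two_le h'
        omega
      · rw [movers_of_not_two_le h', List.length_nil] at e1
        omega
    have m1 : 2 ≤ stackSize (position ω t) (v + 1) → False := by
      intro h
      have hl := length_movers_of_two_le h
      have htk : false ∈ (movers (position ω t) (v + 1)).map (ω t) := by
        rw [word, List.take_append_of_le_length (by simp [hl, h])] at hf
        exact List.mem_of_mem_take hf
      have := List.count_pos_iff.2 htk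
      by_cases h' : 2 ≤ stackSize (position ω t) v
      · have := length_movers_of_two_le h'
        omega
      · rw [movers_of_not_two_le h', List.length_nil] at e0
        omega
    have l0 := stackSize_le_step_of_not_two_le (ω t) m0
    have l1 := stackSize_le_step_of_not_two_le (ω t) m1
    simp only [word, movers_of_not_two_le m0, movers_of_not_two_le m1, List.map_nil,
      List.nil_append] at ht hf
    exact ih (by omega) (by omega) ⟨ht, hf⟩

/-! ### The interval of visited sites -/

/-- The site `v` has been visited by time `t`: it holds a particle, or particles have left it. -/
def Visited (ω : ℕ → Fin n → Bool) (t : ℕ) (v : ℤ) : Prop :=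
  0 < stackSize (position ω t) v ∨ word ω t v ≠ []

lemma Visited.succ {ω : ℕ → Fin n → Bool} {t : ℕ} {v : ℤ} (h : Visited ω t v) :
    Visited ω (t + 1) v := by
  rcases h with h | h
  · by_cases h2 : 2 ≤ stackSize (position ω t) v
    · right
      intro h3
      have := congrArg List.length h3
      simp only [word, List.length_append, List.length_map, length_movers_of_two_le h2,
        List.length_nil] at this
      omega
    · left
      exact h.trans_le (stackSize_le_step_of_not_two_le (ω t) h2)
  · right
    simp [word, h]

lemma Visited.mono {ω : ℕ → Fin n → Bool} {s t : ℕ} {v : ℤ} (hst : s ≤ t)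
    (h : Visited ω s v) : Visited ω t v := by
  induction t, hst using Nat.le_induction with
  | base => exact h
  | succ t _ ih => exact ih.succ

lemma Visited.of_succ {ω : ℕ → Fin n → Bool} {t : ℕ} {v : ℤ} (h : Visited ω (t + 1) v) :
    Visited ω t v ∨ Visited ω t (v - 1) ∨ Visited ω t (v + 1) := by
  by_contra! hc
  simp only [Visited, not_or, not_lt, nonpos_iff_eq_zero, not_not] at hc
  obtain ⟨⟨a, a'⟩, ⟨b, b'⟩, c, c'⟩ := hc
  have e := stackSize_step_add (position ω t) (ω t) v
  rw [movers_of_not_two_le (v := v) (by omega), movers_of_not_two_le (v := v - 1) (by omega),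
    movers_of_not_two_le (v := v + 1) (by omega)] at e
  simp only [List.length_nil, List.map_nil, List.count_nil] at e
  rcases h with h | h
  · simp only [position] at h
    omega
  · simp only [word, movers_of_not_two_le (x := position ω t) (v := v) (by omega)] at h
    exact h (by simpa using a')

/-- The sites visited by time `t` form an interval around the origin. -/
lemma exists_visited_iff (hn : 0 < n) (ω : ℕ → Fin n → Bool) (t : ℕ) :
    ∃ p q : ℕ, ∀ v : ℤ, Visited ω t v ↔ -(p : ℤ) ≤ v ∧ v ≤ q := by
  induction t with
  | zero =>
    refine ⟨0, 0, fun v => ?_⟩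
    simp only [Visited, word, stackSize_zero_position]
    by_cases h : v = 0
    · simp [h, hn]
    · simp only [h, if_false]
      simp
      omega
  | succ t ih =>
    obtain ⟨p, q, h⟩ := ih
    have key : ∀ v, Visited ω (t + 1) v → -(p : ℤ) - 1 ≤ v ∧ v ≤ q + 1 := by
      intro v hv
      rcases hv.of_succ with h1 | h1 | h1 <;> have := (h _).1 h1 <;> omega
    by_cases hp : Visited ω (t + 1) (-(p : ℤ) - 1) <;>
      by_cases hq : Visited ω (t + 1) ((q : ℤ) + 1)
    · refine ⟨p + 1, q + 1, fun v => ⟨fun hv => ?_, fun hv => ?_⟩⟩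
      · have := key v hv
        push_cast
        omega
      · push_cast at hv
        rcases eq_or_ne v (-(p : ℤ) - 1) with rfl | h1
        · exact hp
        rcases eq_or_ne v ((q : ℤ) + 1) with rfl | h2
        · exact hq
        exact ((h v).2 (by omega)).succ
    · refine ⟨p + 1, q, fun v => ⟨fun hv => ?_, fun hv => ?_⟩⟩
      · have := key v hv
        have : v ≠ (q : ℤ) + 1 := by rintro rfl; exact hq hv
        push_cast
        omega
      · push_cast at hv
        rcases eq_or_ne v (-(p : ℤ) - 1) with rfl | h1
        · exact hp
        exact ((h v).2 (by omega)).succ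
    · refine ⟨p, q + 1, fun v => ⟨fun hv => ?_, fun hv => ?_⟩⟩
      · have := key v hv
        have : v ≠ -(p : ℤ) - 1 := by rintro rfl; exact hp hv
        push_cast
        omega
      · push_cast at hv
        rcases eq_or_ne v ((q : ℤ) + 1) with rfl | h2
        · exact hq
        exact ((h v).2 (by omega)).succ
    · refine ⟨p, q, fun v => ⟨fun hv => ?_, fun hv => ?_⟩⟩
      · have := key v hv
        have : v ≠ (q : ℤ) + 1 := by rintro rfl; exact hq hv
        have : v ≠ -(p : ℤ) - 1 := by rintro rfl; exact hp hv
        omega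
      · exact ((h v).2 (by omega)).succ

/-! ### Weighted sums over words -/

lemma tsum_list {α : Type*} (f : List α → ℝ≥0∞) :
    ∑' l, f l = f [] + ∑' (a) (l), f (a :: l) := by
  let e : Option (α × List α) ≃ List α :=
    { toFun := fun o => o.elim [] fun p => p.1 :: p.2
      invFun := fun l => match l with
        | [] => none
        | a :: l => some (a, l)
      left_inv := by rintro (_ | _) <;> rfl
      right_inv := by rintro (_ | _) <;> rfl }
  rw [← e.tsum_eq, ← (Equiv.optionEquivSumPUnit.{0} (α × List α)).symm.tsum_eq,
    Summable.tsum_sum ENNReal.summable ENNReal.summable, add_comm, ENNReal.tsum_prod']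
  simp [e]

/-- The words with exactly `ℓ` letters `false`, each weighted by its probability, have total
weight at most `2`: such a word is read off from fair coins by stopping at the `ℓ`-th `false` and
adding a run of `true`s, and a run of length `j` costs `2 ^ (-j)`. -/
lemma tsum_word_le (ℓ : ℤ) :
    ∑' w : List Bool, (if (w.count false : ℤ) = ℓ then (2⁻¹ : ℝ≥0∞) ^ w.length else 0) ≤ 2 := by
  have key : ∀ (m : ℕ) (ℓ : ℤ), ∑' w : List Bool,
      (if (w.count false : ℤ) = ℓ ∧ w.length < m then (2⁻¹ : ℝ≥0∞) ^ w.length else 0) ≤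
        if 0 ≤ ℓ then 2 else 0 := by
    intro m
    induction m with
    | zero => simp
    | succ m ih =>
      intro ℓ
      rw [tsum_list]
      have h1 : ∀ b : Bool, ∑' w : List Bool, (if ((b :: w).count false : ℤ) = ℓ ∧
          (b :: w).length < m + 1 then (2⁻¹ : ℝ≥0∞) ^ (b :: w).length else 0) ≤
          2⁻¹ * if 0 ≤ (if b then ℓ else ℓ - 1) then 2 else 0 := by
        intro b
        refine le_trans (le_of_eq ?_) (mul_le_mul_right (ih (if b then ℓ else ℓ - 1)) _)
        rw [← ENNReal.tsum_mul_left]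
        refine tsum_congr fun w => ?_
        rw [mul_ite, mul_zero, List.length_cons, pow_succ']
        congr 1
        cases b
        · simp [eq_sub_iff_add_eq]
        · simp
      rw [tsum_bool]
      refine (add_le_add_right (add_le_add (h1 false) (h1 true)) _).trans ?_
      have h2 : (2⁻¹ : ℝ≥0∞) * 2 = 1 := ENNReal.inv_mul_cancel (by simp) (by simp)
      rcases lt_trichotomy ℓ 0 with h | rfl | h
      · simp [h.not_ge, h.ne', show ¬ 1 ≤ ℓ by omega]
      · simp [h2, one_add_one_eq_two]
      · simp [h.le, h.ne, show 1 ≤ ℓ by omega, h2, one_add_one_eq_two]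
  rw [ENNReal.tsum_eq_iSup_sum]
  refine iSup_le fun s => ?_
  obtain ⟨m, hm⟩ : ∃ m, ∀ w ∈ s, w.length < m :=
    ⟨s.sup List.length + 1, fun w hw => Nat.lt_succ_of_le (Finset.le_sup hw)⟩
  refine le_trans ?_ ((ENNReal.sum_le_tsum s).trans ((key m ℓ).trans ?_))
  · refine Finset.sum_le_sum fun w hw => ?_
    simp [hm w hw]
  · split_ifs <;> simp

/-! ### The transfer sum over admissible profiles -/

/-- The condition on the word `w` of an empty site. The Boolean `s` says that the site to the left
is empty and that a particle went right there in one of its last two moves, in which case the last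
two moves here were to the right. -/
def EmptyOK (s : Bool) (w : List Bool) : Prop :=
  2 ≤ w.length ∧ (s = true → false ∉ w.take 2)

instance (s : Bool) (w : List Bool) : Decidable (EmptyOK s w) :=
  inferInstanceAs (Decidable (_ ∧ _))

/-- The Boolean that a site with `k` particles and word `w` hands over to the condition `EmptyOK`
of the next site. -/
def nextState (k : ℕ) (w : List Bool) : Bool := decide (k = 0 ∧ true ∈ w.take 2)

/-- Constraints on the numbers of particles and the words of consecutive sites, read from left to
right. The list starts at the site `v`, whose word must have `ℓ` letters `false`; `r` is the number
of letters `true` in the word of `v - 1`. By conservation of particles, the number of letters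
`false` in the next word is then prescribed as well. -/
def Admissible (n : ℕ) : Bool → ℤ → ℤ → ℤ → List (ℕ × List Bool) → Prop
  | _, _, _, _, [] => True
  | s, v, r, ℓ, (k, w) :: e =>
    ((w.count false : ℤ) = ℓ ∧ (k = 0 → EmptyOK s w)) ∧
      Admissible n (nextState k w) (v + 1) (w.count true)
        (k + w.length - r - if v = 0 then n else 0) e

/-- The weight `65⁻¹ ^ k * 2⁻¹ ^ |w|` of a site with `k` particles and word `w`. The factor
`65⁻¹` per particle makes occupied sites so light that the transfer sum decays exponentially in
the number of sites. -/
noncomputable def siteWeight (a : ℕ × List Bool) : ℝ≥0∞ := 65⁻¹ ^ a.1 * 2⁻¹ ^ a.2.length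

/-- The product of the weights of the sites in a list. -/
noncomputable def listWeight (e : List (ℕ × List Bool)) : ℝ≥0∞ := (e.map siteWeight).prod

/-- A vector that the transfer operator multiplies by at most `3 / 4`. -/
noncomputable def potential (s : Bool) : ℝ≥0∞ := if s then 1 else 8

lemma tsum_emptyOK_le (s : Bool) (ℓ : ℤ) :
    ∑' w : List Bool, (if (w.count false : ℤ) = ℓ ∧ EmptyOK s w then
      2⁻¹ ^ w.length * potential (nextState 0 w) else 0) ≤
      if s then 2⁻¹ else 4 + 3 * 2⁻¹ := by
  -- the first two letters are fixed; the rest of the word has weight at most `2`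
  set f : List Bool → ℝ≥0∞ := fun w => if (w.count false : ℤ) = ℓ ∧ EmptyOK s w then
      2⁻¹ ^ w.length * potential (nextState 0 w) else 0 with hf
  have h2 : (2⁻¹ : ℝ≥0∞) * 2 = 1 := ENNReal.inv_mul_cancel (by simp) (by simp)
  have key : ∀ a b : Bool, ∑' w : List Bool, f (a :: b :: w) ≤
      if s = true ∧ (a = false ∨ b = false) then 0 else 2⁻¹ * potential (a || b) := by
    intro a b
    split_ifs with h
    · simp only [nonpos_iff_eq_zero, ENNReal.tsum_eq_zero, hf]
      intro w
      rw [if_neg]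
      rintro ⟨-, -, h3⟩
      have := h3 h.1
      rcases h.2 with h4 | h4 <;> simp [h4] at this
    · refine le_trans (ENNReal.tsum_le_tsum fun w => ?_)
        (((ENNReal.tsum_mul_left (a := 2⁻¹ * 2⁻¹ * potential (a || b)) (f := fun w : List Bool =>
          if (w.count false : ℤ) = ℓ - ([a, b].count false : ℕ) then
            (2⁻¹ : ℝ≥0∞) ^ w.length else 0)).le.trans
          (mul_le_mul_right (tsum_word_le _) _)).trans (le_of_eq ?_))
      · simp only [hf]
        by_cases h3 : ((a :: b :: w).count false : ℤ) = ℓ ∧ EmptyOK s (a :: b :: w)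
        · have h4 : (w.count false : ℤ) = ℓ - ([a, b].count false : ℕ) := by
            rw [← h3.1]
            cases a <;> cases b <;> simp
            ring
          rw [if_pos h3, if_pos h4]
          have h5 : nextState 0 (a :: b :: w) = (a || b) := by
            cases a <;> cases b <;> simp [nextState]
          rw [h5, List.length_cons, List.length_cons]
          apply le_of_eq
          ring
        · rw [if_neg h3]
          exact zero_le
      · calc (2⁻¹ : ℝ≥0∞) * 2⁻¹ * potential (a || b) * 2
            = (2⁻¹ * 2) * (2⁻¹ * potential (a || b)) := by ring
          _ = _ := by rw [h2, one_mul]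
  have hnil : f [] = 0 := by simp [hf, EmptyOK]
  have hsingle : ∀ a, f [a] = 0 := by simp [hf, EmptyOK]
  have hcons : ∀ a, ∑' w, f (a :: w) = ∑' w, f (a :: false :: w) + ∑' w, f (a :: true :: w) := by
    intro a
    rw [tsum_list fun w => f (a :: w), hsingle, zero_add, tsum_bool]
  rw [tsum_list f, hnil, zero_add, tsum_bool, hcons, hcons]
  refine (add_le_add (add_le_add (key _ _) (key _ _)) (add_le_add (key _ _) (key _ _))).trans ?_
  have h8 : (2⁻¹ : ℝ≥0∞) * 8 = 4 := by
    rw [show (8 : ℝ≥0∞) = 2 * 4 by norm_num, ← mul_assoc, h2, one_mul]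
  cases s
  · simp only [potential, Bool.false_eq_true, false_and, if_false, Bool.or_self, Bool.or_true,
      Bool.true_or, if_true, mul_one, h8]
    apply le_of_eq
    ring
  · simp [potential]

lemma tsum_site_le (s : Bool) (ℓ : ℤ) :
    ∑' a : ℕ × List Bool, (if (a.2.count false : ℤ) = ℓ ∧ (a.1 = 0 → EmptyOK s a.2) then
      siteWeight a * potential (nextState a.1 a.2) else 0) ≤ 3 / 4 * potential s := by
  classical
  rw [ENNReal.tsum_prod', tsum_eq_zero_add' ENNReal.summable]
  have h0 := tsum_emptyOK_le s ℓ
  have h1 : ∀ k : ℕ, ∑' w : List Bool, (if (w.count false : ℤ) = ℓ ∧ (k + 1 = 0 → EmptyOK s w) then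
      siteWeight (k + 1, w) * potential (nextState (k + 1) w) else 0) ≤
      65⁻¹ * 16 * 65⁻¹ ^ k := by
    intro k
    refine le_trans (le_of_eq ?_) ((mul_le_mul_right (tsum_word_le ℓ)
      (65⁻¹ * 8 * 65⁻¹ ^ k)).trans (le_of_eq ?_))
    · rw [← ENNReal.tsum_mul_left]
      refine tsum_congr fun w => ?_
      rw [mul_ite, mul_zero]
      simp only [siteWeight, nextState, potential, Nat.add_eq_zero_iff, one_ne_zero, and_false,
        false_and, decide_false, Bool.false_eq_true, if_false, false_implies, and_true]
      congr 1
      ring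
    · rw [show (16 : ℝ≥0∞) = 8 * 2 by norm_num]
      ring
  have h2 : ∑' k : ℕ, (65⁻¹ * 16 * 65⁻¹ ^ k : ℝ≥0∞) = 4⁻¹ := by
    rw [ENNReal.tsum_mul_left, ENNReal.tsum_geometric]
    have hne : (1 - 65⁻¹ : ℝ≥0∞)⁻¹ ≠ ∞ := ENNReal.inv_ne_top.2
      (tsub_pos_of_lt (ENNReal.inv_lt_one.2 (by norm_num))).ne'
    rw [← ENNReal.toReal_eq_toReal_iff' (ENNReal.mul_ne_top (by finiteness) hne) (by simp)]
    rw [ENNReal.toReal_mul, ENNReal.toReal_inv, ENNReal.toReal_sub_of_le (by simp) (by simp)]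
    norm_num
  refine (add_le_add (le_trans (le_of_eq ?_) h0) ((ENNReal.tsum_le_tsum h1).trans h2.le)).trans ?_
  · simp [siteWeight]
  · have hne : (4 : ℝ≥0∞)⁻¹ ≠ ∞ := by simp
    have hne' : (2 : ℝ≥0∞)⁻¹ ≠ ∞ := by simp
    have hne'' : (3 / 4 : ℝ≥0∞) ≠ ∞ := by finiteness
    cases s
    · simp only [potential, Bool.false_eq_true, if_false]
      rw [← ENNReal.toReal_le_toReal (by finiteness) (by finiteness),
        ENNReal.toReal_add (by finiteness) (by finiteness),
        ENNReal.toReal_add (by finiteness) (by finiteness)]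
      norm_num
    · simp only [potential, if_true]
      rw [← ENNReal.toReal_le_toReal (by finiteness) (by finiteness),
        ENNReal.toReal_add (by finiteness) (by finiteness)]
      norm_num

lemma tsum_list_le (n L : ℕ) (s : Bool) (v r ℓ : ℤ) :
    ∑' e : List (ℕ × List Bool), (open Classical in
      if e.length = L ∧ Admissible n s v r ℓ e then listWeight e else 0) ≤
      potential s * (3 / 4) ^ L := by
  classical
  induction L generalizing s v r ℓ with
  | zero =>
    rw [tsum_eq_single []]
    · simp only [Admissible, listWeight, potential]
      cases s <;> simp
    · intro e he
      simp [he]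
  | succ L ih =>
    rw [tsum_list]
    simp only [List.length_nil, Nat.right_eq_add, Nat.add_eq_zero_iff, one_ne_zero, and_false,
      false_and, if_false, zero_add, listWeight]
    have h : ∀ a : ℕ × List Bool, ∑' e : List (ℕ × List Bool),
        (if (a :: e).length = L + 1 ∧ Admissible n s v r ℓ (a :: e)
          then listWeight (a :: e) else 0) ≤
        (if (a.2.count false : ℤ) = ℓ ∧ (a.1 = 0 → EmptyOK s a.2) then
          siteWeight a * potential (nextState a.1 a.2) else 0) * (3 / 4) ^ L := by
      rintro ⟨k, w⟩
      by_cases hl : (w.count false : ℤ) = ℓ ∧ (k = 0 → EmptyOK s w)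
      · rw [if_pos hl, mul_assoc]
        refine le_trans (le_of_eq ?_) (mul_le_mul_right (ih (nextState k w) (v + 1)
          (w.count true) (k + w.length - r - if v = 0 then n else 0)) (siteWeight (k, w)))
        rw [← ENNReal.tsum_mul_left]
        refine tsum_congr fun e => ?_
        have hA : Admissible n s v r ℓ ((k, w) :: e) ↔ Admissible n (nextState k w) (v + 1)
            (w.count true) (k + w.length - r - if v = 0 then n else 0) e := by
          simp only [Admissible]
          exact and_iff_right hl
        simp [hA, listWeight]
      · simp [Admissible, hl]
    refine (ENNReal.tsum_le_tsum h).trans ?_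
    rw [ENNReal.tsum_mul_right, pow_succ', ← mul_assoc]
    gcongr
    rw [mul_comm]
    exact tsum_site_le s ℓ

/-! ### Profiles of the process -/

/-- The numbers of particles and the words at time `t` of the `L` sites from `v` on. -/
def profile (ω : ℕ → Fin n → Bool) (t : ℕ) : ℤ → ℕ → List (ℕ × List Bool)
  | _, 0 => []
  | v, L + 1 => (stackSize (position ω t) v, word ω t v) :: profile ω t (v + 1) L

lemma length_profile (ω : ℕ → Fin n → Bool) (t : ℕ) (v : ℤ) (L : ℕ) :
    (profile ω t v L).length = L := by
  induction L generalizing v with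
  | zero => rfl
  | succ L ih => simp [profile, ih]

lemma word_eq_of_profile_eq {ω ω' : ℕ → Fin n → Bool} {t : ℕ} {v : ℤ} {L : ℕ}
    (h : profile ω t v L = profile ω' t v L) {u : ℤ} (hu : v ≤ u) (hu' : u < v + L) :
    word ω t u = word ω' t u := by
  induction L generalizing v with
  | zero => simp at hu'; omega
  | succ L ih =>
    simp only [profile, List.cons.injEq, Prod.mk.injEq] at h
    rcases hu.eq_or_lt with rfl | hlt
    · exact h.1.2
    · exact ih h.2 (by omega) (by push_cast at hu'; omega)

@[to_additive]
lemma prod_map_profile {M : Type*} [CommMonoid M] (f : ℕ × List Bool → M)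
    (ω : ℕ → Fin n → Bool) (t : ℕ) (v : ℤ) (L : ℕ) :
    ((profile ω t v L).map f).prod =
      ∏ u ∈ Finset.Ico v (v + L), f (stackSize (position ω t) u, word ω t u) := by
  induction L generalizing v with
  | zero => simp [profile]
  | succ L ih =>
    have h : Finset.Ico v (v + (L + 1 : ℕ)) = insert v (Finset.Ico (v + 1) (v + 1 + L)) := by
      ext u
      simp only [Finset.mem_Ico, Finset.mem_insert]
      push_cast
      omega
    rw [h, Finset.prod_insert (by simp), ← ih]
    simp [profile]

lemma listWeight_profile (ω : ℕ → Fin n → Bool) (t : ℕ) (v : ℤ) (L : ℕ) :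
    listWeight (profile ω t v L) =
      65⁻¹ ^ (∑ u ∈ Finset.Ico v (v + L), stackSize (position ω t) u) *
        2⁻¹ ^ (∑ u ∈ Finset.Ico v (v + L), (word ω t u).length) := by
  rw [listWeight, prod_map_profile, ← Finset.prod_pow_eq_pow_sum, ← Finset.prod_pow_eq_pow_sum,
    ← Finset.prod_mul_distrib]
  rfl

lemma admissible_profile {ω : ℕ → Fin n → Bool} {t : ℕ} (L : ℕ) {v : ℤ} {s : Bool}
    (hv : ∀ u, v ≤ u → u < v + L → Visited ω t u)
    (hs : s = true → stackSize (position ω t) (v - 1) = 0 ∧ true ∈ (word ω t (v - 1)).take 2) :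
    Admissible n s v ((word ω t (v - 1)).count true) ((word ω t v).count false)
      (profile ω t v L) := by
  induction L generalizing v s with
  | zero => simp [profile, Admissible]
  | succ L ih =>
    refine ⟨⟨rfl, fun h0 => ⟨?_, fun hst hf => ?_⟩⟩, ?_⟩
    · rcases hv v le_rfl (by push_cast; omega) with h | h
      · omega
      · exact two_le_length_word h
    · obtain ⟨h1, h2⟩ := hs hst
      exact not_true_mem_and_false_mem (v := v - 1) h1 (by rwa [sub_add_cancel])
        ⟨h2, by rwa [sub_add_cancel]⟩
    · have hcons : (stackSize (position ω t) v : ℤ) + (word ω t v).length -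
          (word ω t (v - 1)).count true - (if v = 0 then n else 0 : ℕ) =
          (word ω t (v + 1)).count false := by
        have := stackSize_position_add ω t v
        omega
      have := @ih (v + 1) (nextState (stackSize (position ω t) v) (word ω t v))
        (fun u h1 h2 => hv u (by omega) (by push_cast; omega))
        (fun h => by simpa [nextState] using h)
      rwa [add_sub_cancel_right, ← hcons] at this

lemma sum_stackSize_le (x : Fin n → ℤ) (V : Finset ℤ) : ∑ u ∈ V, stackSize x u ≤ n := by
  have h := Finset.card_biUnion (s := V) (t := fun u => Finset.univ.filter fun j => x j = u)
    (fun u _ w _ huw => Finset.disjoint_filter.2 fun j _ h1 h2 => huw (h1.symm.trans h2))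
  unfold stackSize
  rw [← h]
  simpa using Finset.card_le_univ (V.biUnion fun u => Finset.univ.filter fun j => x j = u)

/-- The number of coins read off at the sites in `V` is at most the number of coins used. -/
lemma sum_length_word_le (ω : ℕ → Fin n → Bool) (t : ℕ) (V : Finset ℤ) :
    ∑ u ∈ V, (word ω t u).length ≤ ∑ s ∈ Finset.range t,
      (Finset.univ.filter fun i => 2 ≤ stackSize (position ω s) (position ω s i)).card := by
  induction t with
  | zero => simp [word]
  | succ t ih =>
    simp only [word, List.length_append, List.length_map]
    rw [Finset.sum_add_distrib, Finset.sum_range_succ, add_comm]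
    refine add_le_add ih ?_
    simp only [length_movers]
    rw [← Finset.card_biUnion]
    · refine Finset.card_le_card fun i => ?_
      simp only [Finset.mem_biUnion, Finset.mem_filter, Finset.mem_univ, true_and]
      rintro ⟨_, _, h, _⟩
      exact h
    · exact fun u _ w _ huw => Finset.disjoint_filter.2 fun j _ h1 h2 => huw (h1.2.symm.trans h2.2)

lemma le_sum_length_word {ω : ℕ → Fin n → Bool} {t : ℕ} {V : Finset ℤ}
    (hω : ∀ s < t, ¬ IsDispersed (position ω s)) (hV : ∀ v, word ω t v ≠ [] → v ∈ V) :
    t ≤ ∑ u ∈ V, (word ω t u).length := by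
  induction t with
  | zero => simp
  | succ t ih =>
    have h1 := ih (fun s hs => hω s (by omega)) fun v hv => hV v (by simp [word, hv])
    obtain ⟨v, hv⟩ := not_forall.1 (hω t (by omega))
    have hl := length_movers_of_two_le (x := position ω t) (v := v) (by omega)
    have hvV : v ∈ V := hV v fun h => by
      have := congrArg List.length h
      simp only [word, List.length_append, List.length_map, List.length_nil] at this
      omega
    refine Nat.succ_le_of_lt (h1.trans_lt (Finset.sum_lt_sum (fun u _ => ?_) ⟨v, hvV, ?_⟩))
    · simp [word]
    · simp only [word, List.length_append, List.length_map]
      omega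

/-! ### Probabilities of profiles -/

instance (n : ℕ) : IsProbabilityMeasure (coinLaw n) := by
  unfold coinLaw
  infer_instance

/-- Fixing finitely many coins costs a factor `1 / 2` each. -/
lemma coinLaw_cylinder (n t : ℕ) (ω₀ : ℕ → Fin n → Bool) (F : ℕ → Finset (Fin n)) :
    coinLaw n {ω | ∀ s < t, ∀ i ∈ F s, ω s i = ω₀ s i} =
      2⁻¹ ^ ∑ s ∈ Finset.range t, (F s).card := by
  have h : {ω : ℕ → Fin n → Bool | ∀ s < t, ∀ i ∈ F s, ω s i = ω₀ s i} =
      Set.pi (Finset.range t) fun s => Set.univ.pi fun i =>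
        if i ∈ F s then {ω₀ s i} else Set.univ := by
    ext ω
    simp only [Set.mem_ofPred_eq, Set.mem_pi, Finset.coe_range, Set.mem_Iio, Set.mem_univ,
      true_imp_iff]
    refine forall₂_congr fun s _ => forall_congr' fun i => ?_
    split_ifs with hi <;> simp [hi]
  rw [h, coinLaw, Measure.infinitePi_pi _ fun s _ => (Set.toFinite _).measurableSet,
    ← Finset.prod_pow_eq_pow_sum]
  refine Finset.prod_congr rfl fun s _ => ?_
  rw [Measure.pi_pi]
  have h1 : ∀ i, (PMF.uniformOfFintype Bool).toMeasure
      (if i ∈ F s then {ω₀ s i} else Set.univ) = if i ∈ F s then 2⁻¹ else 1 := by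
    intro i
    split_ifs
    · rw [PMF.toMeasure_apply_singleton _ _ (measurableSet_singleton _)]
      simp
    · exact measure_univ
  simp only [h1]
  rw [Finset.prod_ite_mem, Finset.univ_inter, Finset.prod_const]

/-- The visited interval at time `t` is `[-p, q]` and `e` is the profile on it. -/
def HasProfile (ω : ℕ → Fin n → Bool) (t : ℕ) (c : ℕ × ℕ × List (ℕ × List Bool)) : Prop :=
  (∀ v : ℤ, Visited ω t v ↔ -(c.1 : ℤ) ≤ v ∧ v ≤ c.2.1) ∧
    c.2.2 = profile ω t (-c.1) (c.1 + c.2.1 + 1)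

lemma exists_hasProfile (hn : 0 < n) (ω : ℕ → Fin n → Bool) (t : ℕ) :
    ∃ c, HasProfile ω t c := by
  obtain ⟨p, q, h⟩ := exists_visited_iff hn ω t
  exact ⟨(p, q, profile ω t (-p) (p + q + 1)), h, rfl⟩

open Classical in
/-- An upper bound for the probability of a profile. The factor `65 ^ n` compensates the factors
`65⁻¹` for the at most `n` particles in `listWeight`. -/
noncomputable def profileBound (n : ℕ) (c : ℕ × ℕ × List (ℕ × List Bool)) : ℝ≥0∞ :=
  if c.2.2.length = c.1 + c.2.1 + 1 ∧ Admissible n false (-c.1) 0 0 c.2.2 then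
    65 ^ n * listWeight c.2.2 else 0

/-- The words determine all the coins that were used, so that a profile has probability at most
`2 ^ (-m)`, where `m` is the total length of its words. -/
lemma coinLaw_hasProfile_le (n t : ℕ) (c : ℕ × ℕ × List (ℕ × List Bool)) :
    coinLaw n {ω | HasProfile ω t c} ≤ profileBound n c := by
  rcases Set.eq_empty_or_nonempty {ω : ℕ → Fin n → Bool | HasProfile ω t c} with h | ⟨ω₀, h₀⟩
  · simp [h]
  obtain ⟨p, q, e⟩ := c
  obtain ⟨hvis, he⟩ := h₀
  simp only at hvis he
  have hout : ∀ ω : ℕ → Fin n → Bool, (∀ v : ℤ, Visited ω t v ↔ -(p : ℤ) ≤ v ∧ v ≤ q) →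
      ∀ v, ¬ (-(p : ℤ) ≤ v ∧ v ≤ q) → stackSize (position ω t) v = 0 ∧ word ω t v = [] := by
    intro ω hω v hv
    rw [← hω, Visited] at hv
    push Not at hv
    exact ⟨by omega, hv.2⟩
  have hadm : e.length = p + q + 1 ∧ Admissible n false (-p) 0 0 e := by
    refine ⟨by rw [he, length_profile], ?_⟩
    obtain ⟨h1, h2⟩ := hout ω₀ hvis (-p - 1) (by omega)
    have h3 := stackSize_position_add ω₀ t (-p - 1)
    rw [h1, h2, sub_add_cancel] at h3
    have h4 := admissible_profile (ω := ω₀) (t := t) (p + q + 1) (v := -p) (s := false)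
      (fun u hu hu' => (hvis u).2 ⟨hu, by push_cast at hu'; omega⟩) (by simp)
    have h5 : (word ω₀ t (-p)).count false = 0 := by
      simp only [List.length_nil] at h3
      omega
    rw [h2, h5] at h4
    rw [he]
    simpa using h4
  have hsub : {ω : ℕ → Fin n → Bool | HasProfile ω t (p, q, e)} ⊆
      {ω | ∀ s < t, ∀ i ∈ (fun s => Finset.univ.filter fun i =>
        2 ≤ stackSize (position ω₀ s) (position ω₀ s i)) s, ω s i = ω₀ s i} := by
    rintro ω ⟨hω, hωe⟩ s hs i hi
    simp only [Finset.mem_filter, Finset.mem_univ, true_and] at hi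
    refine coin_eq_of_word_eq (fun v => ?_) s hs i hi
    by_cases hv : -(p : ℤ) ≤ v ∧ v ≤ q
    · exact word_eq_of_profile_eq (hωe.symm.trans he) hv.1 (by push_cast; omega)
    · rw [(hout ω hω v hv).2, (hout ω₀ hvis v hv).2]
  refine (measure_mono hsub).trans ?_
  rw [coinLaw_cylinder, profileBound, if_pos hadm]
  simp only
  rw [he, listWeight_profile]
  set V := Finset.Ico (-(p : ℤ)) (-p + (p + q + 1 : ℕ))
  calc (2⁻¹ : ℝ≥0∞) ^ _ ≤ 2⁻¹ ^ (∑ u ∈ V, (word ω₀ t u).length) :=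
        pow_le_pow_of_le_one zero_le (by simp) (sum_length_word_le ω₀ t V)
    _ = (65 ^ n * 65⁻¹ ^ n) * 2⁻¹ ^ (∑ u ∈ V, (word ω₀ t u).length) := by
        rw [← mul_pow, ENNReal.mul_inv_cancel (by simp) (by simp), one_pow, one_mul]
    _ ≤ _ := by
        rw [mul_assoc]
        exact mul_le_mul_right (mul_le_mul_left
          (pow_le_pow_of_le_one zero_le (by simp) (sum_stackSize_le _ V)) _) _

/-- The total bound for the profiles on intervals `[-p, q]` with `K ≤ p + q` decays exponentially
in `K`. -/
lemma tsum_profileBound_le (n K : ℕ) :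
    ∑' c : ℕ × ℕ × List (ℕ × List Bool), (if K ≤ c.1 + c.2.1 then profileBound n c else 0) ≤
      512 * 65 ^ n * (7 / 8) ^ K := by
  have h78 : (7 / 8 : ℝ≥0∞) ≤ 1 := ENNReal.div_le_of_le_mul (by norm_num)
  -- of the two factors `7 / 8`, one gives the decay in `K` and the other the sum over `p` and `q`
  have hr : (3 / 4 : ℝ≥0∞) ≤ 7 / 8 * (7 / 8) := by
    rw [← ENNReal.toReal_le_toReal (by finiteness) (by finiteness)]
    norm_num
  have hpq : ∀ p q : ℕ, ∑' e, (if K ≤ p + q then profileBound n (p, q, e) else 0) ≤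
      8 * 65 ^ n * (7 / 8) ^ K * (7 / 8) ^ p * (7 / 8) ^ q := by
    intro p q
    by_cases hK : K ≤ p + q
    · simp only [if_pos hK]
      calc ∑' e, profileBound n (p, q, e)
          ≤ 65 ^ n * (potential false * (3 / 4) ^ (p + q + 1)) := by
            refine le_trans (le_of_eq ?_)
              (mul_le_mul_right (tsum_list_le n (p + q + 1) false (-p) 0 0) _)
            rw [← ENNReal.tsum_mul_left]
            simp [profileBound]
        _ ≤ 65 ^ n * (8 * ((7 / 8) ^ (p + q) * (7 / 8) ^ K)) := by
            simp only [potential, Bool.false_eq_true, if_false]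
            gcongr
            calc (3 / 4 : ℝ≥0∞) ^ (p + q + 1) ≤ (3 / 4) ^ (p + q) :=
                  pow_le_pow_of_le_one zero_le (ENNReal.div_le_of_le_mul (by norm_num)) (by omega)
              _ ≤ (7 / 8 * (7 / 8)) ^ (p + q) := by gcongr
              _ = (7 / 8) ^ (p + q) * (7 / 8) ^ (p + q) := mul_pow _ _ _
              _ ≤ _ := by
                  exact mul_le_mul_right (pow_le_pow_of_le_one zero_le h78 hK) _
        _ = _ := by ring
    · simp [hK]
  have hgeo : ∑' j : ℕ, (7 / 8 : ℝ≥0∞) ^ j = 8 := by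
    have h : (1 : ℝ≥0∞) - 7 / 8 = 8⁻¹ := by
      rw [← ENNReal.toReal_eq_toReal_iff' (by finiteness) (by simp),
        ENNReal.toReal_sub_of_le h78 (by simp)]
      norm_num
    rw [ENNReal.tsum_geometric, h, inv_inv]
  rw [ENNReal.tsum_prod']
  refine (ENNReal.tsum_le_tsum fun p => (ENNReal.tsum_prod'.trans_le
    (ENNReal.tsum_le_tsum fun q => hpq p q))).trans (le_of_eq ?_)
  simp only [ENNReal.tsum_mul_left, ENNReal.tsum_mul_right, hgeo]
  rw [show (512 : ℝ≥0∞) = 8 * 8 * 8 by norm_num]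
  ring

/-! ### Escape and termination -/

lemma coinLaw_exists_visited_le (hn : 0 < n) (K : ℕ) :
    coinLaw n {ω | ∃ t, ∃ v : ℤ, K ≤ v.natAbs ∧ Visited ω t v} ≤ 512 * 65 ^ n * (7 / 8) ^ K := by
  have hU : {ω : ℕ → Fin n → Bool | ∃ t, ∃ v : ℤ, K ≤ v.natAbs ∧ Visited ω t v} =
      ⋃ t, {ω | ∃ v : ℤ, K ≤ v.natAbs ∧ Visited ω t v} := by
    ext ω
    simp
  have hmono : Monotone fun t => {ω : ℕ → Fin n → Bool | ∃ v : ℤ, K ≤ v.natAbs ∧ Visited ω t v} :=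
    fun s t hst ω ⟨v, hv, h⟩ => ⟨v, hv, h.mono hst⟩
  rw [hU, hmono.measure_iUnion]
  refine iSup_le fun t => ?_
  refine le_trans ?_ (tsum_profileBound_le n K)
  have hsub : {ω : ℕ → Fin n → Bool | ∃ v : ℤ, K ≤ v.natAbs ∧ Visited ω t v} ⊆
      ⋃ c : ℕ × ℕ × List (ℕ × List Bool), {ω | K ≤ c.1 + c.2.1 ∧ HasProfile ω t c} := by
    rintro ω ⟨v, hv, h⟩
    obtain ⟨c, hc⟩ := exists_hasProfile hn ω t
    have := (hc.1 v).1 h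
    exact Set.mem_iUnion.2 ⟨c, by omega, hc⟩
  refine (measure_mono hsub).trans ((measure_iUnion_le _).trans (ENNReal.tsum_le_tsum fun c => ?_))
  split_ifs with hK
  · simpa [hK] using coinLaw_hasProfile_le n t c
  · simp [hK]

/-- The process stops almost surely: as long as it goes on, the total length of the words is at
least the time, while the bounds for the probabilities of all profiles have a finite sum. -/
lemma coinLaw_forall_not_isDispersed (hn : 0 < n) :
    coinLaw n {ω | ∀ t, ¬ IsDispersed (position ω t)} = 0 := by
  have hfin : ∑' c, profileBound n c ≠ ∞ := by
    refine ne_top_of_le_ne_top ?_ ((le_of_eq (by simp)).trans (tsum_profileBound_le n 0))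
    finiteness
  refine le_antisymm (ge_of_tendsto' (ENNReal.tendsto_tsum_compl_atTop_zero hfin) fun S => ?_)
    zero_le
  -- at the time `t` the total length of the words exceeds that of all profiles in `S`
  set size : ℕ × ℕ × List (ℕ × List Bool) → ℕ := fun c => (c.2.2.map fun a => a.2.length).sum
  set t := S.sup size + 1
  have hsub : {ω : ℕ → Fin n → Bool | ∀ t, ¬ IsDispersed (position ω t)} ⊆
      ⋃ c : {c // c ∉ S}, {ω | HasProfile ω t c} := by
    intro ω hω
    obtain ⟨c, hc⟩ := exists_hasProfile hn ω t
    refine Set.mem_iUnion.2 ⟨⟨c, fun hcS => ?_⟩, hc⟩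
    have h1 : size c ≤ S.sup size := Finset.le_sup hcS
    have h2 : size c = ∑ u ∈ Finset.Ico (-(c.1 : ℤ)) (-c.1 + (c.1 + c.2.1 + 1 : ℕ)),
        (word ω t u).length := by
      simp only [size, hc.2, sum_map_profile]
    have h3 := le_sum_length_word (t := t) (V := Finset.Ico (-(c.1 : ℤ))
      (-c.1 + (c.1 + c.2.1 + 1 : ℕ))) (fun s _ => hω s) fun v hv => by
        have := (hc.1 v).1 (Or.inr hv)
        simp only [Finset.mem_Ico]
        push_cast
        omega
    omega
  exact (measure_mono hsub).trans ((measure_iUnion_le _).trans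
    (ENNReal.tsum_le_tsum fun c => coinLaw_hasProfile_le n t c))

end Dispersion

theorem theorem1 :
    ∃ C : ℝ, 0 < C ∧
      Tendsto
        (fun n : ℕ => Dispersion.coinLaw n
          {ω | ∃ T : ℕ, Dispersion.StopsAt ω T ∧
            ∀ i : Fin n, |(Dispersion.position ω T i : ℝ)| ≤ C * (n : ℝ)})
        atTop (𝓝 1) := by
  classical
  refine ⟨64, by norm_num, ?_⟩
  have hlow : ∀ᶠ n : ℕ in atTop, 1 - 512 * (2⁻¹ : ENNReal) ^ n ≤ Dispersion.coinLaw n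
      {ω | ∃ T : ℕ, Dispersion.StopsAt ω T ∧
        ∀ i : Fin n, |(Dispersion.position ω T i : ℝ)| ≤ 64 * (n : ℝ)} := by
    filter_upwards [eventually_gt_atTop 0] with n hn
    set G := {ω : ℕ → Fin n → Bool | ∃ T : ℕ, Dispersion.StopsAt ω T ∧
        ∀ i : Fin n, |(Dispersion.position ω T i : ℝ)| ≤ 64 * (n : ℝ)}
    set A := {ω : ℕ → Fin n → Bool | ∀ t, ¬ Dispersion.IsDispersed (Dispersion.position ω t)}
    set B := {ω : ℕ → Fin n → Bool |
      ∃ t, ∃ v : ℤ, 64 * n ≤ v.natAbs ∧ Dispersion.Visited ω t v}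
    have hcover : Set.univ ⊆ G ∪ (A ∪ B) := by
      intro ω _
      by_cases hA : ω ∈ A
      · exact Or.inr (Or.inl hA)
      by_cases hB : ω ∈ B
      · exact Or.inr (Or.inr hB)
      left
      simp only [A, Set.mem_ofPred_eq, not_forall, not_not] at hA
      refine ⟨Nat.find hA, ⟨Nat.find_spec hA, fun t ht => Nat.find_min hA ht⟩, fun i => ?_⟩
      set T := Nat.find hA
      by_contra! hi
      refine hB ⟨T, Dispersion.position ω T i, ?_, Or.inl ?_⟩
      · have : (64 * n : ℝ) < ((Dispersion.position ω T i).natAbs : ℝ) := by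
          rwa [Nat.cast_natAbs, Int.cast_abs]
        exact_mod_cast this.le
      · exact Finset.card_pos.2 ⟨i, by simp⟩
    have hB : Dispersion.coinLaw n B ≤ 512 * (2⁻¹ : ENNReal) ^ n := by
      refine (Dispersion.coinLaw_exists_visited_le hn _).trans ?_
      -- the constant `64` is chosen such that `65 * (7 / 8) ^ 64 ≤ 1 / 2`
      rw [mul_assoc, pow_mul, ← mul_pow]
      gcongr
      rw [← ENNReal.toReal_le_toReal (by finiteness) (by finiteness)]
      norm_num
    rw [tsub_le_iff_right]
    calc (1 : ENNReal) = Dispersion.coinLaw n Set.univ := measure_univ.symm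
      _ ≤ Dispersion.coinLaw n (G ∪ (A ∪ B)) := measure_mono hcover
      _ ≤ Dispersion.coinLaw n G + (Dispersion.coinLaw n A + Dispersion.coinLaw n B) :=
          (measure_union_le _ _).trans (add_le_add_right (measure_union_le _ _) _)
      _ ≤ _ := by
          rw [Dispersion.coinLaw_forall_not_isDispersed hn, zero_add]
          gcongr
  refine tendsto_of_tendsto_of_tendsto_of_le_of_le' ?_ tendsto_const_nhds hlow
    (Eventually.of_forall fun n => prob_le_one)
  have h0 : Tendsto (fun n : ℕ => 512 * (2⁻¹ : ENNReal) ^ n) atTop (𝓝 0) := by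
    simpa using ENNReal.Tendsto.const_mul
      (ENNReal.tendsto_pow_atTop_nhds_zero_of_lt_one (r := 2⁻¹) (by simp)) (a := 512)
      (Or.inr (by simp))
  simpa using ENNReal.Tendsto.sub tendsto_const_nhds h0 (Or.inl ENNReal.one_ne_top)
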